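/- Let $N_r\ge 1$ and $N_t>1$ be integers, let $\lambda_1,\lambda_2,\lambda_3,\lambda_4,P_S,P_J,N_D,N_E>0$ and $0\le\rho\le 1$. Let $h_{sd}$ (a scalar), $\mathbf h_{se}$ (an $N_r\times 1$ vector), $\mathbf h_{ed}$ (a $1\times N_t$ vector) and $\mathbf H_{ee}$ (an $N_r\times N_t$ matrix) be random, with all entries mutually independent, zero-mean, circularly symmetric complex Gaussian, of variance $\lambda_1$, $\lambda_2$, $\lambda_3$ and $\lambda_4$ respectively. For a receive vector $\mathbf w_r$ and a transmit vector $\mathbf w_t$, and with the jamming power equal to its maximum $P_J$, put $$\mathrm{SINR}_D=\frac{P_S|h_{sd}|^2}{P_J|\mathbf h_{ed}\mathbf w_t|^2+N_D},\qquad \mathrm{SINR}_E=\frac{P_S|\mathbf w_r^\dagger\mathbf h_{se}|^2}{\rho P_J|\mathbf w_r^\dagger\mathbf H_{ee}\mathbf w_t|^2+N_E},$$ and let $X=1$ if $\mathrm{SINR}_E\ge\mathrm{SINR}_D$ and $X=0$ otherwise. In the TZF/MRC scheme, $\mathbf w_r=\mathbf h_{se}/\|\mathbf h_{se}\|$, and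 $\mathbf w_t$ is (almost surely) a maximizer of $|\mathbf h_{ed}\mathbf w|^2$ over all $\mathbf w\in\mathbb C^{N_t}$ with $\|\mathbf w\|=1$ and $\mathbf h_{se}^\dagger\mathbf H_{ee}\mathbf w=0$. Almost surely, one such maximizer is $\mathbf w_t=\mathbf\Pi_1\mathbf h_{ed}^\dagger/\|\mathbf\Pi_1\mathbf h_{ed}^\dagger\|$, where $\mathbf\Pi_1=\mathbf I_{N_t}-\dfrac{\mathbf H_{ee}^\dagger\mathbf h_{se}\mathbf h_{se}^\dagger\mathbf H_{ee}}{\|\mathbf h_{se}^\dagger\mathbf H_{ee}\|^2}$; and for this and every other choice of the maximizer, the eavesdropping non-outage probability of the TZF/MRC scheme is exactly $$\mathbb E\{X\}=1-\sum_{k=0}^{N_t-2}\frac{(-1)^k}{k!\,(N_t-k-2)!}\left(\frac{\lambda_1N_E}{\lambda_2\lambda_3P_J}\right)^{N_r}\beta^k\,e^{\beta}\,\Gamma(N_t-N_r-k-1,\beta),\qquad \beta=\frac{N_D}{\lambda_3P_J}+\frac{\lambda_1N_E}{\lambda_2\lambda_3P_J},$$ where $\Gamma(s,x)=\int_x^\infty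 t^{s-1}e^{-t}\,dt$ is the upper incomplete gamma function (for any real $s$ and $x>0$). -/

import Mathlib

open MeasureTheory ProbabilityTheory Matrix

noncomputable section

namespace Surveillance

/-- The Euclidean norm of a complex vector. -/
def l2norm {n : ℕ} (v : Fin n → ℂ) : ℝ :=
  ‖(WithLp.toLp 2 v : EuclideanSpace ℂ (Fin n))‖

/-- The law of a zero-mean (circularly symmetric) complex Gaussian variable `Z` with variance
`E|Z|² = v`: real and imaginary part are independent, centred Gaussian, of variance `v / 2`. -/
def complexGaussian (v : ℝ) : Measure ℂ :=
  ((gaussianReal 0 (v / 2).toNNReal).prod (gaussianReal 0 (v / 2).toNNReal)).map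
    (fun p : ℝ × ℝ => (⟨p.1, p.2⟩ : ℂ))

/-- The upper incomplete gamma function `Γ(s, x) = ∫_x^∞ t^(s-1) e^(-t) dt`, for real `s` and
`x > 0`. -/
def upperGamma (s x : ℝ) : ℝ :=
  ∫ t in Set.Ioi x, t ^ (s - 1) * Real.exp (-t)

/-- All scalar channel coefficients (`S → D`, `S → E`, `E → D` and the loop channel `E → E`)
as one family of complex random variables. -/
def channelCoeff {Ω : Type*} {Nr Nt : ℕ} (hsd : Ω → ℂ) (hse : Ω → Fin Nr → ℂ)
    (hed : Ω → Fin Nt → ℂ) (Hee : Ω → Matrix (Fin Nr) (Fin Nt) ℂ) :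
    Unit ⊕ Fin Nr ⊕ Fin Nt ⊕ (Fin Nr × Fin Nt) → Ω → ℂ
  | .inl _, ω => hsd ω
  | .inr (.inl i), ω => hse ω i
  | .inr (.inr (.inl j)), ω => hed ω j
  | .inr (.inr (.inr ij)), ω => Hee ω ij.1 ij.2

/-- The fading model: all channel coefficients are mutually independent zero-mean complex
Gaussian variables, with variance `lam1` (`S → D`), `lam2` (`S → E`), `lam3` (`E → D`),
`lam4` (loop channel). -/
structure FadingModel {Ω : Type*} [MeasurableSpace Ω] (P : Measure Ω) {Nr Nt : ℕ}
    (lam1 lam2 lam3 lam4 : ℝ) (hsd : Ω → ℂ) (hse : Ω → Fin Nr → ℂ)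
    (hed : Ω → Fin Nt → ℂ) (Hee : Ω → Matrix (Fin Nr) (Fin Nt) ℂ) : Prop where
  law_sd : HasLaw hsd (complexGaussian lam1) P
  law_se : ∀ i, HasLaw (fun ω => hse ω i) (complexGaussian lam2) P
  law_ed : ∀ j, HasLaw (fun ω => hed ω j) (complexGaussian lam3) P
  law_ee : ∀ i j, HasLaw (fun ω => Hee ω i j) (complexGaussian lam4) P
  indep : iIndepFun (channelCoeff hsd hse hed Hee) P

/-- The SINR at the suspicious receiver, `P_S |h_sd|² / (p_d |h_ed w_t|² + N_D)`. -/
def sinrD {Nt : ℕ} (PS pd ND : ℝ) (hsd : ℂ) (hed wt : Fin Nt → ℂ) : ℝ :=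
  PS * ‖hsd‖ ^ 2 / (pd * ‖hed ⬝ᵥ wt‖ ^ 2 + ND)

/-- The SINR at the monitor, `P_S |w_r† h_se|² / (ρ p_d |w_r† H_ee w_t|² + N_E)`. -/
def sinrE {Nr Nt : ℕ} (PS pd ρ NE : ℝ) (hse : Fin Nr → ℂ) (Hee : Matrix (Fin Nr) (Fin Nt) ℂ)
    (wr : Fin Nr → ℂ) (wt : Fin Nt → ℂ) : ℝ :=
  PS * ‖star wr ⬝ᵥ hse‖ ^ 2 / (ρ * pd * ‖star wr ⬝ᵥ (Hee *ᵥ wt)‖ ^ 2 + NE)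

/-- The indicator of successful eavesdropping: `1` if `SINR_E ≥ SINR_D`, and `0` otherwise. -/
def eavesdropSuccess {Nr Nt : ℕ} (PS pd ρ ND NE : ℝ) (hsd : ℂ) (hse : Fin Nr → ℂ)
    (hed : Fin Nt → ℂ) (Hee : Matrix (Fin Nr) (Fin Nt) ℂ)
    (wr : Fin Nr → ℂ) (wt : Fin Nt → ℂ) : ℝ :=
  if sinrE PS pd ρ NE hse Hee wr wt ≥ sinrD PS pd ND hsd hed wt then 1 else 0

/-- The MRC receive vector `h_se / ‖h_se‖`. -/
def mrcReceive {Nr : ℕ} (hse : Fin Nr → ℂ) : Fin Nr → ℂ :=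
  (((l2norm hse)⁻¹ : ℝ) : ℂ) • hse

/-- The feasible transmit vectors of transmit zero-forcing: unit vectors `w` with
`h_se† H_ee w = 0`. -/
def tzfFeasible {Nr Nt : ℕ} (hse : Fin Nr → ℂ) (Hee : Matrix (Fin Nr) (Fin Nt) ℂ) :
    Set (Fin Nt → ℂ) :=
  {w | star hse ⬝ᵥ (Hee *ᵥ w) = 0 ∧ l2norm w = 1}

/-- `wt` is an optimal zero-forcing transmit vector: it is feasible and maximizes
`|h_ed w|²` over the feasible vectors `w`. -/
def IsTZFTransmit {Nr Nt : ℕ} (hse : Fin Nr → ℂ) (hed : Fin Nt → ℂ)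
    (Hee : Matrix (Fin Nr) (Fin Nt) ℂ) (wt : Fin Nt → ℂ) : Prop :=
  wt ∈ tzfFeasible hse Hee ∧ IsMaxOn (fun w => ‖hed ⬝ᵥ w‖ ^ 2) (tzfFeasible hse Hee) wt

/-- The matrix `Π₁ = I - H_ee† h_se h_se† H_ee / ‖h_se† H_ee‖²`. -/
def tzfProj {Nr Nt : ℕ} (hse : Fin Nr → ℂ) (Hee : Matrix (Fin Nr) (Fin Nt) ℂ) :
    Matrix (Fin Nt) (Fin Nt) ℂ :=
  1 - (((l2norm (star hse ᵥ* Hee) ^ 2)⁻¹ : ℝ) : ℂ) • (Heeᴴ * vecMulVec hse (star hse) * Hee)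

/-- The vector `Π₁ h_ed† / ‖Π₁ h_ed†‖`. -/
def tzfTransmit {Nr Nt : ℕ} (hse : Fin Nr → ℂ) (hed : Fin Nt → ℂ)
    (Hee : Matrix (Fin Nr) (Fin Nt) ℂ) : Fin Nt → ℂ :=
  (((l2norm (tzfProj hse Hee *ᵥ star hed))⁻¹ : ℝ) : ℂ) • (tzfProj hse Hee *ᵥ star hed)

end Surveillance

end

/-! ### The scalar complex Gaussian law. -/

namespace Surveillance

/-! Write `b` for the vector `h_se† H_ee`. Zero-forcing makes the monitor's SINR equal to `P_S
‖h_se‖² / N_E`. By Cauchy–Schwarz the largest feasible `|h_ed w|²` is `V`, the squared norm of the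
part of `h_ed` orthogonal to `b`. Every maximizer attains `V`, so success fails exactly when
`|h_sd|²` exceeds `T = ‖h_se‖² (P_J V + N_D) / N_E` (`eavesdropSuccess_eq`).

Since `|h_sd|²` is exponential, averaging over `h_sd` gives `exp (-T / λ₁)`. Given `b ≠ 0`, unitary
invariance makes `V` a sum of `N_t - 1` independent exponentials, so averaging over `h_ed` gives a
power of `1 + e ‖h_se‖²` that no longer involves `b` (`integral_exp_neg_orthogonalNormSq`); this is
how `λ₄` drops out.

There remains the mean of `exp (-d R) (1 + e R)^(-(N_t - 1))` with `R = ‖h_se‖²`. Reading the second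
factor as the Laplace transform of a gamma variable `t` and exchanging integrals leaves only the
Laplace transform of `R`, which is `K^N_r (t + β)^(-N_r)`
(`integral_exp_neg_mul_inv_pow_gaussianVector`). Shifting `t` by `β` and expanding binomially
produces the incomplete gamma functions (`integral_pow_mul_exp_neg_mul_inv_add_pow`). -/

instance isProbabilityMeasure_complexGaussian (v : ℝ) :
    IsProbabilityMeasure (complexGaussian v) :=
  Measure.isProbabilityMeasure_map Complex.measurableEquivRealProd.symm.measurable.aemeasurable

lemma integral_complexGaussian_eq_prod {E : Type*} [NormedAddCommGroup E] [NormedSpace ℝ E]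
    (v : ℝ) (g : ℂ → E) :
    ∫ z, g z ∂complexGaussian v =
      ∫ p : ℝ × ℝ, g ⟨p.1, p.2⟩
        ∂(gaussianReal 0 (v / 2).toNNReal).prod (gaussianReal 0 (v / 2).toNNReal) :=
  integral_map_equiv Complex.measurableEquivRealProd.symm g

/-- The density of the complex Gaussian law. -/
lemma integral_complexGaussian {v : ℝ} (hv : 0 < v) (g : ℂ → ℝ) :
    ∫ z, g z ∂complexGaussian v =
      ∫ z : ℂ, (Real.pi * v)⁻¹ * Real.exp (-‖z‖ ^ 2 / v) * g z := by
  have hv2 : (v / 2).toNNReal ≠ 0 := by simpa using hv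
  have hc : (((v / 2).toNNReal : NNReal) : ℝ) = v / 2 := Real.coe_toNNReal _ (by positivity)
  rw [integral_complexGaussian_eq_prod, gaussianReal_of_var_ne_zero _ hv2,
    prod_withDensity (measurable_gaussianPDF _ _) (measurable_gaussianPDF _ _),
    integral_withDensity_eq_integral_toReal_smul]
  · rw [← Measure.volume_eq_prod, ← Complex.volume_preserving_equiv_real_prod.integral_comp
      Complex.measurableEquivRealProd.measurableEmbedding]
    refine integral_congr_ae (ae_of_all _ fun z => ?_)
    simp only [Complex.measurableEquivRealProd_apply, smul_eq_mul, gaussianPDF,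
      gaussianPDFReal, ENNReal.toReal_mul]
    rw [ENNReal.toReal_ofReal (by positivity), ENNReal.toReal_ofReal (by positivity), hc,
      mul_mul_mul_comm, ← Real.exp_add, ← mul_inv, Real.mul_self_sqrt (by positivity),
      Complex.sq_norm, Complex.normSq_apply]
    congr 2
    · congr 1; ring
    · congr 1; field_simp; ring
  · exact (measurable_gaussianPDF _ _).comp measurable_fst |>.mul
      ((measurable_gaussianPDF _ _).comp measurable_snd)
  · exact ae_of_all _ fun p => ENNReal.mul_lt_top (by simp [gaussianPDF]) (by simp [gaussianPDF])

/-- Polar coordinates: the factor `2π r` cancels the `π` of the density. -/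
lemma integral_complexGaussian_norm {v : ℝ} (hv : 0 < v) (f : ℝ → ℝ) :
    ∫ z, f ‖z‖ ∂complexGaussian v =
      ∫ r in Set.Ioi (0 : ℝ), 2 / v * r * Real.exp (-r ^ 2 / v) * f r := by
  rw [integral_complexGaussian hv (fun z => f ‖z‖),
    integral_fun_norm_addHaar volume (fun r => (Real.pi * v)⁻¹ * Real.exp (-r ^ 2 / v) * f r),
    Complex.finrank_real_complex, Measure.real, Complex.volume_ball]
  simp only [ENNReal.ofReal_one, one_pow, one_mul, ENNReal.coe_toReal, NNReal.coe_real_pi,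
    nsmul_eq_mul, smul_eq_mul, Nat.cast_ofNat]
  rw [← integral_const_mul, ← integral_const_mul]
  refine integral_congr_ae (ae_of_all _ fun r => ?_)
  have := Real.pi_ne_zero
  simp only [Nat.add_one_sub_one, pow_one]
  field_simp

/-- The truncated Laplace transform of `‖z‖ ^ 2` for a complex Gaussian `z`. -/
lemma integral_exp_neg_sq_norm_of_lt_complexGaussian {v s x : ℝ} (hv : 0 < v) (hs : 0 ≤ s)
    (hx : 0 ≤ x) :
    ∫ z, (if x < ‖z‖ ^ 2 then Real.exp (-(s * ‖z‖ ^ 2)) else 0) ∂complexGaussian v =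
      Real.exp (-((s + v⁻¹) * x)) / (1 + s * v) := by
  have hc : 0 < s + v⁻¹ := by positivity
  rw [integral_complexGaussian_norm hv
    (fun r => if x < r ^ 2 then Real.exp (-(s * r ^ 2)) else 0)]
  have h1 : ∫ r in Set.Ioi (0 : ℝ), 2 / v * r * Real.exp (-r ^ 2 / v) *
      (if x < r ^ 2 then Real.exp (-(s * r ^ 2)) else 0) =
      ∫ r in Set.Ioi (√x), 2 / v * r * Real.exp (-((s + v⁻¹) * r ^ 2)) := by
    rw [← integral_indicator measurableSet_Ioi, ← integral_indicator measurableSet_Ioi]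
    refine integral_congr_ae (ae_of_all _ fun r => ?_)
    by_cases h0 : 0 < r
    · have hiff : x < r ^ 2 ↔ √x < r := (Real.sqrt_lt' h0).symm
      by_cases h : √x < r
      · simp only [Set.indicator, Set.mem_Ioi, h0, h, hiff, if_true]
        rw [mul_assoc, ← Real.exp_add]
        congr 2
        field_simp
        ring
      · simp [Set.indicator, Set.mem_Ioi, h, hiff]
    · have : ¬ √x < r := fun h => h0 ((Real.sqrt_nonneg x).trans_lt h)
      simp [Set.indicator, h0, this]
  -- The factor `r` makes the integrand an exact derivative.
  rw [h1, integral_Ioi_of_hasDerivAt_of_nonneg'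
    (g := fun r => -(Real.exp (-((s + v⁻¹) * r ^ 2)) / (1 + s * v))) (l := 0)]
  · simp [Real.sq_sqrt hx]
  · intro r _
    have h2 : HasDerivAt (fun r : ℝ => -((s + v⁻¹) * r ^ 2)) (-((s + v⁻¹) * (2 * r))) r := by
      simpa using! ((hasDerivAt_pow 2 r).const_mul (s + v⁻¹)).fun_neg
    refine (h2.exp.div_const (1 + s * v)).fun_neg.congr_deriv ?_
    have : 1 + s * v ≠ 0 := by positivity
    field_simp
    ring
  · intro r hr
    have : 0 < r := (Real.sqrt_nonneg x).trans_lt hr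
    positivity
  · have h3 : Filter.Tendsto (fun r : ℝ => (s + v⁻¹) * r ^ 2) Filter.atTop Filter.atTop :=
      (Filter.tendsto_pow_atTop two_ne_zero).const_mul_atTop hc
    simpa using ((Real.tendsto_exp_neg_atTop_nhds_zero.comp h3).div_const (1 + s * v)).neg

lemma complexGaussian_ae_ne_zero {v : ℝ} (hv : 0 < v) : ∀ᵐ z ∂complexGaussian v, z ≠ 0 := by
  have hv2 : (v / 2).toNNReal ≠ 0 := by simpa using hv
  have := nullSingletonClass_gaussianReal (μ := 0) hv2
  have h : {z : ℂ | ¬ z ≠ 0} = {0} := by ext; simp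
  have h' : Complex.measurableEquivRealProd.symm ⁻¹' {0} = {(0 : ℝ)} ×ˢ {(0 : ℝ)} := by
    ext p
    simp [Complex.ext_iff, Prod.ext_iff]
  rw [ae_iff, h]
  change Measure.map Complex.measurableEquivRealProd.symm _ _ = 0
  rw [MeasurableEquiv.map_apply, h', Measure.prod_prod]
  simp

lemma integral_exp_neg_sq_norm_complexGaussian {v s : ℝ} (hv : 0 < v) (hs : 0 ≤ s) :
    ∫ z, Real.exp (-(s * ‖z‖ ^ 2)) ∂complexGaussian v = (1 + s * v)⁻¹ := by
  have h := integral_exp_neg_sq_norm_of_lt_complexGaussian hv hs le_rfl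
  simp only [mul_zero, neg_zero, Real.exp_zero, one_div] at h
  rw [← h]
  refine integral_congr_ae ?_
  filter_upwards [complexGaussian_ae_ne_zero hv] with z hz
  rw [if_pos (by positivity)]

lemma charFun_complexGaussian {v : ℝ} (hv : 0 < v) (w : ℂ) :
    charFun (complexGaussian v) w = Complex.exp (-(v / 4 * ‖w‖ ^ 2 : ℝ)) := by
  have hc : (((v / 2).toNNReal : NNReal) : ℝ) = v / 2 := Real.coe_toNNReal _ (by positivity)
  rw [charFun_apply, integral_complexGaussian_eq_prod]
  have h : ∀ p : ℝ × ℝ, Complex.exp ((inner ℝ (⟨p.1, p.2⟩ : ℂ) w : ℝ) * Complex.I) =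
      Complex.exp (w.re * p.1 * Complex.I) * Complex.exp (w.im * p.2 * Complex.I) := by
    intro p
    rw [← Complex.exp_add, Complex.inner]
    congr 1
    simp
    ring
  simp_rw [h]
  rw [integral_prod_mul (fun x : ℝ => Complex.exp (w.re * x * Complex.I))
    (fun x : ℝ => Complex.exp (w.im * x * Complex.I)), ← charFun_apply_real, ← charFun_apply_real,
    charFun_gaussianReal, charFun_gaussianReal, ← Complex.exp_add, Complex.sq_norm,
    Complex.normSq_apply, hc]
  congr 1
  push_cast
  ring

end Surveillance

/-! ### Gaussian vectors and unitary invariance. -/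

namespace Surveillance

section GaussianVector

variable {ι : Type*} [Fintype ι]

/-- The law of a vector of i.i.d. complex Gaussian variables, on the Euclidean space. -/
noncomputable def gaussianVector (ι : Type*) [Fintype ι] (v : ℝ) :
    Measure (EuclideanSpace ℂ ι) :=
  (Measure.pi fun _ : ι => complexGaussian v).map (WithLp.toLp 2)

instance isProbabilityMeasure_gaussianVector (v : ℝ) :
    IsProbabilityMeasure (gaussianVector ι v) :=
  Measure.isProbabilityMeasure_map (WithLp.measurable_toLp 2 _).aemeasurable

lemma measurePreserving_toLp_gaussianVector (v : ℝ) :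
    MeasurePreserving (WithLp.toLp 2) (Measure.pi fun _ : ι => complexGaussian v)
      (gaussianVector ι v) :=
  ⟨WithLp.measurable_toLp 2 _, rfl⟩

lemma integral_gaussianVector {E : Type*} [NormedAddCommGroup E] [NormedSpace ℝ E] (v : ℝ)
    (f : EuclideanSpace ℂ ι → E) :
    ∫ x, f x ∂gaussianVector ι v =
      ∫ x, f (WithLp.toLp 2 x) ∂Measure.pi fun _ : ι => complexGaussian v :=
  integral_map_equiv (MeasurableEquiv.toLp 2 (ι → ℂ)) f

/-- Dependence on `‖t‖` alone is what yields unitary invariance. -/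
lemma charFun_gaussianVector {v : ℝ} (hv : 0 < v) (t : EuclideanSpace ℂ ι) :
    charFun (gaussianVector ι v) t = Complex.exp (-(v / 4 * ‖t‖ ^ 2 : ℝ)) := by
  rw [gaussianVector, charFun_pi]
  simp_rw [charFun_complexGaussian hv]
  rw [← Complex.exp_sum, EuclideanSpace.norm_sq_eq, Finset.mul_sum]
  push_cast
  rw [Finset.sum_neg_distrib]

/-- A vector of i.i.d. complex Gaussian variables is unitarily invariant. -/
lemma measurePreserving_gaussianVector {v : ℝ} (hv : 0 < v)
    (L : EuclideanSpace ℂ ι ≃ₗᵢ[ℂ] EuclideanSpace ℂ ι) :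
    MeasurePreserving L (gaussianVector ι v) (gaussianVector ι v) := by
  have hL : Measurable L := L.continuous.measurable
  refine ⟨hL, ?_⟩
  have : IsProbabilityMeasure ((gaussianVector ι v).map L) :=
    Measure.isProbabilityMeasure_map hL.aemeasurable
  refine Measure.ext_of_charFun (funext fun t => ?_)
  -- Polarization expresses the real inner product through norms, which `L` preserves.
  have hinner : ∀ x, inner ℝ (L x) t = inner ℝ x (L.symm t) := by
    intro x
    rw [real_inner_eq_norm_add_mul_self_sub_norm_mul_self_sub_norm_mul_self_div_two,
      real_inner_eq_norm_add_mul_self_sub_norm_mul_self_sub_norm_mul_self_div_two,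
      L.norm_map, L.symm.norm_map, ← L.norm_map (x + _), map_add, L.apply_symm_apply]
  rw [charFun_apply, integral_map hL.aemeasurable (by fun_prop)]
  simp_rw [hinner]
  rw [← charFun_apply, charFun_gaussianVector hv, charFun_gaussianVector hv, L.symm.norm_map]

lemma gaussianVector_ae_apply_ne_zero {v : ℝ} (hv : 0 < v) (i : ι) :
    ∀ᵐ x ∂gaussianVector ι v, x i ≠ 0 := by
  rw [gaussianVector, ← MeasurableEquiv.coe_toLp, (MeasurableEquiv.toLp 2 (ι → ℂ)).measurableEmbedding.ae_map_iff]
  exact (measurePreserving_eval (fun _ : ι => complexGaussian v) i).quasiMeasurePreserving.ae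
    (complexGaussian_ae_ne_zero hv)

lemma exists_orthonormalBasis_apply_eq (i : ι) {u : EuclideanSpace ℂ ι} (hu : ‖u‖ = 1) :
    ∃ b : OrthonormalBasis ι ℂ (EuclideanSpace ℂ ι), b i = u := by
  classical
  have hon : Orthonormal ℂ (({i} : Set ι).domRestrict fun _ => u) := by
    rw [orthonormal_iff_ite]
    rintro ⟨a, ha⟩ ⟨c, hc⟩
    obtain rfl : a = i := ha
    obtain rfl : c = a := hc
    simp [Set.domRestrict, hu]
  obtain ⟨b, hb⟩ := hon.exists_orthonormalBasis_extension_of_card_eq (by simp)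
  exact ⟨b, hb i rfl⟩

/-- A unitary map sends `a / ‖a‖` to a coordinate vector, which reduces the claim to a single
coordinate. -/
lemma gaussianVector_ae_inner_ne_zero {v : ℝ} (hv : 0 < v) {a : EuclideanSpace ℂ ι}
    (ha : a ≠ 0) : ∀ᵐ x ∂gaussianVector ι v, inner ℂ a x ≠ 0 := by
  obtain ⟨i⟩ : Nonempty ι := by
    by_contra h
    rw [not_nonempty_iff] at h
    exact ha (Subsingleton.elim _ _)
  have hna : ‖a‖ ≠ 0 := norm_ne_zero_iff.2 ha
  obtain ⟨b, hb⟩ := exists_orthonormalBasis_apply_eq i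
    (u := ((‖a‖⁻¹ : ℝ) : ℂ) • a) (by rw [norm_smul]; simp [hna])
  filter_upwards [(measurePreserving_gaussianVector hv b.repr).quasiMeasurePreserving.ae
    (gaussianVector_ae_apply_ne_zero hv i)] with x hx h
  rw [b.repr_apply_apply, hb, inner_smul_left, h, mul_zero] at hx
  exact hx rfl

/-- The squared norm of the component of `h` orthogonal to `b`. -/
noncomputable def orthogonalNormSq (b h : EuclideanSpace ℂ ι) : ℝ :=
  ‖h‖ ^ 2 - ‖inner ℂ b h‖ ^ 2 / ‖b‖ ^ 2

/-- In an orthonormal basis whose `i`-th vector is `a / ‖a‖`, removing the component along `a`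
deletes coordinate `i`. -/
lemma exists_orthogonalNormSq_eq_sum [DecidableEq ι] (i : ι) {a : EuclideanSpace ℂ ι}
    (ha : a ≠ 0) :
    ∃ L : EuclideanSpace ℂ ι ≃ₗᵢ[ℂ] EuclideanSpace ℂ ι,
      ∀ x, orthogonalNormSq a x = ∑ j ∈ Finset.univ.erase i, ‖L x j‖ ^ 2 := by
  have hna : ‖a‖ ≠ 0 := norm_ne_zero_iff.2 ha
  obtain ⟨b, hb⟩ := exists_orthonormalBasis_apply_eq i
    (u := ((‖a‖⁻¹ : ℝ) : ℂ) • a) (by rw [norm_smul]; simp [hna])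
  refine ⟨b.repr, fun x => ?_⟩
  have h1 : ‖b.repr x i‖ ^ 2 = ‖inner ℂ a x‖ ^ 2 / ‖a‖ ^ 2 := by
    rw [b.repr_apply_apply, hb, inner_smul_left, norm_mul, mul_pow]
    simp
    field_simp
  rw [orthogonalNormSq, ← h1, ← b.repr.norm_map x, EuclideanSpace.norm_sq_eq,
    ← Finset.add_sum_erase _ _ (Finset.mem_univ i)]
  ring

lemma integral_exp_neg_orthogonalNormSq {v s : ℝ} (hv : 0 < v) (hs : 0 ≤ s)
    {a : EuclideanSpace ℂ ι} (ha : a ≠ 0) :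
    ∫ x, Real.exp (-(s * orthogonalNormSq a x)) ∂gaussianVector ι v =
      (1 + s * v)⁻¹ ^ (Fintype.card ι - 1) := by
  classical
  obtain ⟨i⟩ : Nonempty ι := by
    by_contra h
    rw [not_nonempty_iff] at h
    exact ha (Subsingleton.elim _ _)
  obtain ⟨L, hL⟩ := exists_orthogonalNormSq_eq_sum i ha
  simp_rw [hL]
  rw [(measurePreserving_gaussianVector hv L).integral_comp
    L.toHomeomorph.measurableEmbedding
    (fun x => Real.exp (-(s * ∑ j ∈ Finset.univ.erase i, ‖x j‖ ^ 2))), integral_gaussianVector]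
  -- The factor `1` at `i` lets the product run over all of `ι`, as Fubini requires.
  have h : ∀ x : ι → ℂ, Real.exp (-(s * ∑ j ∈ Finset.univ.erase i, ‖x j‖ ^ 2)) =
      ∏ j, if j = i then 1 else Real.exp (-(s * ‖x j‖ ^ 2)) := by
    intro x
    rw [← Finset.mul_prod_erase _ _ (Finset.mem_univ i), if_pos rfl, one_mul, Finset.mul_sum,
      ← Finset.sum_neg_distrib, Real.exp_sum]
    exact Finset.prod_congr rfl fun j hj => (if_neg (Finset.ne_of_mem_erase hj)).symm
  simp only [h]
  rw [integral_fintype_prod_eq_prod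
    (fun j (z : ℂ) => if j = i then (1 : ℝ) else Real.exp (-(s * ‖z‖ ^ 2))),
    ← Finset.mul_prod_erase _ _ (Finset.mem_univ i)]
  simp only [if_true, integral_const, probReal_univ, smul_eq_mul, mul_one, one_mul]
  rw [Finset.prod_congr rfl fun j hj => by
    simp only [if_neg (Finset.ne_of_mem_erase hj)]
    exact integral_exp_neg_sq_norm_complexGaussian hv hs]
  simp

lemma integral_exp_neg_norm_sq_gaussianVector {v s : ℝ} (hv : 0 < v) (hs : 0 ≤ s) :
    ∫ x, Real.exp (-(s * ‖x‖ ^ 2)) ∂gaussianVector ι v = (1 + s * v)⁻¹ ^ Fintype.card ι := by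
  rw [integral_gaussianVector]
  simp only [EuclideanSpace.norm_sq_eq, Finset.mul_sum, ← Finset.sum_neg_distrib, Real.exp_sum]
  rw [integral_fintype_prod_eq_prod (fun _ (z : ℂ) => Real.exp (-(s * ‖z‖ ^ 2)))]
  simp [integral_exp_neg_sq_norm_complexGaussian hv hs]

lemma gaussianVector_ae_orthogonalNormSq_pos [Nontrivial ι] {v : ℝ} (hv : 0 < v)
    {a : EuclideanSpace ℂ ι} (ha : a ≠ 0) :
    ∀ᵐ x ∂gaussianVector ι v, 0 < orthogonalNormSq a x := by
  classical
  obtain ⟨i, j, hij⟩ := exists_pair_ne ι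
  obtain ⟨L, hL⟩ := exists_orthogonalNormSq_eq_sum i ha
  filter_upwards [(measurePreserving_gaussianVector hv L).quasiMeasurePreserving.ae
    (gaussianVector_ae_apply_ne_zero hv j)] with x hx
  rw [hL]
  exact Finset.sum_pos' (fun _ _ => by positivity)
    ⟨j, Finset.mem_erase.2 ⟨hij.symm, Finset.mem_univ _⟩, by positivity⟩

end GaussianVector

end Surveillance

/-! ### Optimal zero-forcing beamforming. -/

namespace Surveillance

section ZeroForcing

/-- The component of `h` orthogonal to `b`. -/
noncomputable def orthogonalPart {ι : Type*} [Fintype ι] (b h : EuclideanSpace ℂ ι) :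
    EuclideanSpace ℂ ι :=
  h - (inner ℂ b h / ‖b‖ ^ 2 : ℂ) • b

lemma inner_orthogonalPart {ι : Type*} [Fintype ι] (b h : EuclideanSpace ℂ ι) :
    inner ℂ b (orthogonalPart b h) = 0 := by
  by_cases hb : b = 0
  · simp [hb]
  have : (‖b‖ : ℂ) ≠ 0 := by simpa using hb
  rw [orthogonalPart, inner_sub_right, inner_smul_right, inner_self_eq_norm_sq_to_K]
  simp only [Complex.coe_algebraMap]
  field_simp
  simp

lemma norm_sq_orthogonalPart {ι : Type*} [Fintype ι] (b h : EuclideanSpace ℂ ι) :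
    ‖orthogonalPart b h‖ ^ 2 = orthogonalNormSq b h := by
  have h1 : h = orthogonalPart b h + (inner ℂ b h / ‖b‖ ^ 2 : ℂ) • b := by simp [orthogonalPart]
  have h2 : ‖h‖ * ‖h‖ = ‖orthogonalPart b h‖ * ‖orthogonalPart b h‖ +
      ‖(inner ℂ b h / ‖b‖ ^ 2 : ℂ) • b‖ * ‖(inner ℂ b h / ‖b‖ ^ 2 : ℂ) • b‖ := by
    conv_lhs => rw [h1]
    refine norm_add_sq_eq_norm_sq_add_norm_sq_of_inner_eq_zero (𝕜 := ℂ) _ _ ?_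
    rw [inner_smul_right, inner_eq_zero_symm.1 (inner_orthogonalPart b h), mul_zero]
  rw [orthogonalNormSq, sq ‖h‖, h2]
  by_cases hb : b = 0
  · simp [hb, sq]
  have : ‖b‖ ≠ 0 := by simpa using hb
  rw [norm_smul]
  simp
  field_simp
  ring

variable {Nr Nt : ℕ} (hse : Fin Nr → ℂ) (hed : Fin Nt → ℂ) (Hee : Matrix (Fin Nr) (Fin Nt) ℂ)

/-- The interference channel `h_se† H_ee` seen after maximum ratio combining. -/
noncomputable def loopChannel : EuclideanSpace ℂ (Fin Nt) :=
  WithLp.toLp 2 (star hse ᵥ* Hee)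

lemma dotProduct_eq_inner {n : ℕ} (h w : Fin n → ℂ) :
    h ⬝ᵥ w = inner ℂ (WithLp.toLp 2 (star w)) (WithLp.toLp 2 h : EuclideanSpace ℂ (Fin n)) := by
  simp [EuclideanSpace.inner_eq_star_dotProduct]

lemma l2norm_star {n : ℕ} (w : Fin n → ℂ) : l2norm (star w) = l2norm w := by
  simp [l2norm, EuclideanSpace.norm_eq]

variable {hse Hee} in
-- Feasibility says that `star w` is orthogonal to the loop channel, so subtracting a multiple of
-- that channel changes nothing.
lemma dotProduct_eq_inner_orthogonalPart {w : Fin Nt → ℂ} (hw : w ∈ tzfFeasible hse Hee) :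
    hed ⬝ᵥ w = inner ℂ (WithLp.toLp 2 (star w))
      (orthogonalPart (loopChannel hse Hee) (WithLp.toLp 2 hed)) := by
  have h1 : inner ℂ (WithLp.toLp 2 (star w)) (loopChannel hse Hee) = 0 := by
    rw [loopChannel, ← dotProduct_eq_inner, ← dotProduct_mulVec]
    exact hw.1
  rw [dotProduct_eq_inner, orthogonalPart, inner_sub_right, inner_smul_right, h1, mul_zero,
    sub_zero]

variable {hse Hee} in
lemma norm_dotProduct_sq_le {w : Fin Nt → ℂ} (hw : w ∈ tzfFeasible hse Hee) :
    ‖hed ⬝ᵥ w‖ ^ 2 ≤ orthogonalNormSq (loopChannel hse Hee) (WithLp.toLp 2 hed) := by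
  rw [dotProduct_eq_inner_orthogonalPart hed hw, ← norm_sq_orthogonalPart]
  have h := norm_inner_le_norm (𝕜 := ℂ) (WithLp.toLp 2 (star w))
    (orthogonalPart (loopChannel hse Hee) (WithLp.toLp 2 hed))
  have h2 : ‖(WithLp.toLp 2 (star w) : EuclideanSpace ℂ (Fin Nt))‖ = 1 :=
    (l2norm_star w).trans hw.2
  rw [h2, one_mul] at h
  gcongr

/-- The matrix acts on the conjugate of `hed`, whereas `orthogonalPart` acts on `hed` itself; hence
the outer `star`. -/
lemma tzfProj_mulVec_star :
    tzfProj hse Hee *ᵥ star hed =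
      star (orthogonalPart (loopChannel hse Hee) (WithLp.toLp 2 hed)).ofLp := by
  have h1 : (Heeᴴ * vecMulVec hse (star hse) * Hee) *ᵥ star hed =
      (star hse ᵥ* Hee ⬝ᵥ star hed) • star (star hse ᵥ* Hee) := by
    rw [star_vecMul, star_star, Matrix.mul_assoc, ← mulVec_mulVec, ← mulVec_mulVec, vecMulVec_mulVec,
      ← dotProduct_mulVec]
    simp [mulVec_smul]
  have h2 : inner ℂ (loopChannel hse Hee) (WithLp.toLp 2 hed) =
      star (star hse ᵥ* Hee ⬝ᵥ star hed) := by
    rw [loopChannel, EuclideanSpace.inner_eq_star_dotProduct]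
    change hed ⬝ᵥ star (star hse ᵥ* Hee) = _
    generalize star hse ᵥ* Hee = x
    simp [dotProduct, mul_comm]
  rw [tzfProj, sub_mulVec, one_mulVec, smul_mulVec, h1, orthogonalPart, h2]
  ext i
  simp [l2norm, loopChannel]
  ring

variable {hse hed Hee}

/-- The normalized conjugate of the orthogonal part is the equality case of Cauchy–Schwarz;
positivity permits the normalization. -/
lemma tzfTransmit_spec
    (h : 0 < orthogonalNormSq (loopChannel hse Hee) (WithLp.toLp 2 hed)) :
    tzfTransmit hse hed Hee ∈ tzfFeasible hse Hee ∧
      ‖hed ⬝ᵥ tzfTransmit hse hed Hee‖ ^ 2 =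
        orthogonalNormSq (loopChannel hse Hee) (WithLp.toLp 2 hed) := by
  rw [← norm_sq_orthogonalPart] at h ⊢
  set p := orthogonalPart (loopChannel hse Hee) (WithLp.toLp 2 hed) with hp
  have hp0 : ‖p‖ ≠ 0 := by
    intro h0
    simp [h0] at h
  have ht : tzfTransmit hse hed Hee = ((‖p‖⁻¹ : ℝ) : ℂ) • star p.ofLp := by
    rw [tzfTransmit, tzfProj_mulVec_star, ← hp, l2norm_star]
    rfl
  have hstar : (WithLp.toLp 2 (star (tzfTransmit hse hed Hee)) : EuclideanSpace ℂ (Fin Nt)) =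
      ((‖p‖⁻¹ : ℝ) : ℂ) • p := by
    rw [ht]
    ext i
    simp
  have hf : tzfTransmit hse hed Hee ∈ tzfFeasible hse Hee := by
    constructor
    · rw [dotProduct_mulVec, dotProduct_eq_inner, hstar, inner_smul_left]
      change _ * inner ℂ p (loopChannel hse Hee) = 0
      rw [inner_eq_zero_symm.1 (inner_orthogonalPart _ _), mul_zero]
    · rw [← l2norm_star, l2norm, hstar, norm_smul]
      simp [hp0]
  refine ⟨hf, ?_⟩
  rw [dotProduct_eq_inner_orthogonalPart hed hf, ← hp, hstar, inner_smul_left,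
    inner_self_eq_norm_sq_to_K]
  simp
  field_simp

lemma isTZFTransmit_tzfTransmit
    (h : 0 < orthogonalNormSq (loopChannel hse Hee) (WithLp.toLp 2 hed)) :
    IsTZFTransmit hse hed Hee (tzfTransmit hse hed Hee) := by
  refine ⟨(tzfTransmit_spec h).1, fun w hw => ?_⟩
  simp only [Set.mem_ofPred_eq, (tzfTransmit_spec h).2]
  exact norm_dotProduct_sq_le hed hw

lemma IsTZFTransmit.norm_dotProduct_sq {w : Fin Nt → ℂ} (hw : IsTZFTransmit hse hed Hee w)
    (h : 0 < orthogonalNormSq (loopChannel hse Hee) (WithLp.toLp 2 hed)) :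
    ‖hed ⬝ᵥ w‖ ^ 2 = orthogonalNormSq (loopChannel hse Hee) (WithLp.toLp 2 hed) := by
  refine le_antisymm (norm_dotProduct_sq_le hed hw.1) ?_
  rw [← (tzfTransmit_spec h).2]
  exact hw.2 (tzfTransmit_spec h).1

/-- With an optimal zero-forcing transmit vector and the MRC receive vector, the monitor
succeeds unless `|h_sd|²` exceeds an explicit threshold. -/
lemma eavesdropSuccess_eq {PS PJ ρ ND NE : ℝ} (hPS : 0 < PS) (hPJ : 0 < PJ) (hND : 0 < ND)
    (hNE : 0 < NE) {hsd : ℂ} {w : Fin Nt → ℂ} (hw : IsTZFTransmit hse hed Hee w)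
    (h : 0 < orthogonalNormSq (loopChannel hse Hee) (WithLp.toLp 2 hed)) (hse0 : hse ≠ 0) :
    eavesdropSuccess PS PJ ρ ND NE hsd hse hed Hee (mrcReceive hse) w =
      1 - if l2norm hse ^ 2 *
          (PJ * orthogonalNormSq (loopChannel hse Hee) (WithLp.toLp 2 hed) + ND) / NE <
            ‖hsd‖ ^ 2 then 1 else 0 := by
  have hn : l2norm hse ≠ 0 := by simpa [l2norm] using hse0
  have h1 : star (mrcReceive hse) ⬝ᵥ (Hee *ᵥ w) = 0 := by
    rw [mrcReceive, star_smul, smul_dotProduct, hw.1.1, smul_zero]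
  have h2 : ‖star (mrcReceive hse) ⬝ᵥ hse‖ ^ 2 = l2norm hse ^ 2 := by
    have h3 : star hse ⬝ᵥ hse = ((l2norm hse ^ 2 : ℝ) : ℂ) := by
      have := inner_self_eq_norm_sq_to_K (𝕜 := ℂ) (WithLp.toLp 2 hse : EuclideanSpace ℂ (Fin Nr))
      rw [EuclideanSpace.inner_eq_star_dotProduct, dotProduct_comm] at this
      rw [this, l2norm]
      simp
    rw [mrcReceive, star_smul, smul_dotProduct, h3]
    simp
    field_simp
    rw [sq_abs]
  rw [eavesdropSuccess, sinrD, sinrE, h1, h2, hw.norm_dotProduct_sq h]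
  set V := orthogonalNormSq (loopChannel hse Hee) (WithLp.toLp 2 hed)
  have hV : 0 < PJ * V + ND := by positivity
  -- The self-interference vanishes, so `ρ` disappears, and `PS` cancels.
  have hiff : PS * l2norm hse ^ 2 / (ρ * PJ * ‖(0 : ℂ)‖ ^ 2 + NE) ≥
      PS * ‖hsd‖ ^ 2 / (PJ * V + ND) ↔
      ¬ l2norm hse ^ 2 * (PJ * V + ND) / NE < ‖hsd‖ ^ 2 := by
    simp only [norm_zero, ne_eq, OfNat.ofNat_ne_zero, not_false_eq_true, zero_pow, mul_zero,
      zero_add, ge_iff_le, not_lt]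
    rw [div_le_div_iff₀ hV hNE, le_div_iff₀ hNE, mul_assoc, mul_assoc, mul_le_mul_iff_right₀ hPS]
  simp only [hiff]
  split_ifs <;> simp_all

end ZeroForcing

end Surveillance

/-! ### Gamma law and incomplete gamma function. -/

namespace Surveillance

lemma integrableOn_rpow_mul_exp_neg_Ioi (s : ℝ) {x : ℝ} (hx : 0 < x) :
    IntegrableOn (fun t : ℝ => t ^ s * Real.exp (-t)) (Set.Ioi x) := by
  refine integrable_of_isBigO_exp_neg (b := 1 / 2) (by norm_num) ?_ ?_
  · refine ContinuousOn.mul (fun t ht => ?_) (by fun_prop)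
    exact (Real.continuousAt_rpow_const t s (Or.inl (hx.trans_le ht).ne')).continuousWithinAt
  · simpa only [mul_comm] using (Real.Gamma_integrand_isLittleO s).isBigO

/-- The shifted negative moments of the gamma law with integer shape, in terms of the upper
incomplete gamma function. -/
lemma integral_pow_mul_exp_neg_mul_inv_add_pow (M N : ℕ) {β : ℝ} (hβ : 0 < β) :
    ∫ v in Set.Ioi (0 : ℝ), v ^ M * Real.exp (-v) / M.factorial * ((v + β) ^ N)⁻¹ =
      ∑ k ∈ Finset.range (M + 1), (-1 : ℝ) ^ k / (k.factorial * (M - k).factorial) * β ^ k *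
        Real.exp β * upperGamma ((M : ℝ) + 1 - N - k) β := by
  have hshift : ∫ v in Set.Ioi (0 : ℝ), v ^ M * Real.exp (-v) / M.factorial * ((v + β) ^ N)⁻¹ =
      ∫ t in Set.Ioi β, (t - β) ^ M * Real.exp (-(t - β)) / M.factorial * (t ^ N)⁻¹ := by
    have := (measurePreserving_add_right volume β).setIntegral_preimage_emb
      (measurableEmbedding_addRight β)
      (fun t => (t - β) ^ M * Real.exp (-(t - β)) / M.factorial * (t ^ N)⁻¹) (Set.Ioi β)
    simpa using this
  have hexpand : ∀ t ∈ Set.Ioi β,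
      (t - β) ^ M * Real.exp (-(t - β)) / M.factorial * (t ^ N)⁻¹ =
      ∑ k ∈ Finset.range (M + 1), (-1 : ℝ) ^ k / (k.factorial * (M - k).factorial) * β ^ k *
        Real.exp β * (t ^ ((M : ℝ) + 1 - N - k - 1) * Real.exp (-t)) := by
    intro t ht
    have ht0 : 0 < t := hβ.trans ht
    have hexp : Real.exp (-(t - β)) = Real.exp β * Real.exp (-t) := by
      rw [← Real.exp_add]
      ring_nf
    -- Writing `-β + t` makes `add_pow` attach the exponent `k` to `-β`.
    rw [hexp, sub_eq_neg_add t β, add_pow, Finset.sum_mul, Finset.sum_div, Finset.sum_mul]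
    refine Finset.sum_congr rfl fun k hk => ?_
    have hkM : k ≤ M := Nat.lt_succ_iff.1 (Finset.mem_range.1 hk)
    -- The total exponent `M - k - N` may be negative, hence the real power.
    have hrpow : t ^ ((M : ℝ) + 1 - N - k - 1) = t ^ (M - k) * (t ^ N)⁻¹ := by
      rw [show (M : ℝ) + 1 - N - k - 1 = ((M - k : ℕ) : ℝ) - (N : ℕ) by
        rw [Nat.cast_sub hkM]; ring, Real.rpow_sub ht0, Real.rpow_natCast, Real.rpow_natCast,
        div_eq_mul_inv]
    rw [hrpow, Nat.cast_choose ℝ hkM, neg_pow β k]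
    have := Nat.factorial_ne_zero M
    field_simp
  rw [hshift, setIntegral_congr_fun measurableSet_Ioi hexpand, integral_finsetSum]
  · simp_rw [integral_const_mul, upperGamma]
  · intro k _
    exact (integrableOn_rpow_mul_exp_neg_Ioi _ hβ).const_mul _

lemma integral_gammaMeasure_succ_one (M : ℕ) (g : ℝ → ℝ) :
    ∫ v, g v ∂gammaMeasure (M + 1) 1 =
      ∫ v in Set.Ioi (0 : ℝ), v ^ M * Real.exp (-v) / M.factorial * g v := by
  have hm : Measurable (gammaPDF (M + 1) 1) :=
    (measurable_gammaPDFReal _ _).ennreal_ofReal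
  rw [gammaMeasure, integral_withDensity_eq_integral_toReal_smul hm
    (ae_of_all _ fun v => by simp [gammaPDF]), ← integral_indicator measurableSet_Ioi]
  have h0 : ∀ᵐ v : ℝ, v ≠ 0 := by simp [ae_iff]
  refine integral_congr_ae ?_
  filter_upwards [h0] with v hv
  rcases lt_or_gt_of_ne hv with h | h
  · simp [gammaPDF_of_neg h, Set.indicator, h.not_gt]
  · rw [gammaPDF_of_nonneg h.le, ENNReal.toReal_ofReal (by positivity),
      Set.indicator_of_mem (Set.mem_Ioi.2 h)]
    simp [Real.Gamma_nat_eq_factorial, div_eq_inv_mul, mul_assoc]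

lemma integral_exp_neg_gammaMeasure_succ_one (M : ℕ) {s : ℝ} (hs : 0 ≤ s) :
    ∫ v, Real.exp (-(s * v)) ∂gammaMeasure (M + 1) 1 = (1 + s)⁻¹ ^ (M + 1) := by
  rw [integral_gammaMeasure_succ_one]
  have h := Real.integral_rpow_mul_exp_neg_mul_Ioi (a := M + 1) (r := 1 + s)
    (by positivity) (by positivity)
  rw [Real.Gamma_nat_eq_factorial, ← Nat.cast_succ, Real.rpow_natCast] at h
  have hM : (M.factorial : ℝ) ≠ 0 := by positivity
  rw [← one_div, eq_div_of_mul_eq hM h.symm, ← integral_div]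
  refine setIntegral_congr_fun measurableSet_Ioi fun t ht => ?_
  simp only [Nat.cast_succ, add_sub_cancel_right, Real.rpow_natCast]
  rw [div_mul_eq_mul_div, mul_assoc, ← Real.exp_add]
  ring_nf

lemma gammaMeasure_ae_pos (a r : ℝ) : ∀ᵐ v ∂gammaMeasure a r, 0 < v := by
  have hm : Measurable (gammaPDF a r) := (measurable_gammaPDFReal _ _).ennreal_ofReal
  rw [gammaMeasure, ae_withDensity_iff hm]
  have h0 : ∀ᵐ v : ℝ, v ≠ 0 := by simp [ae_iff]
  filter_upwards [h0] with v hv h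
  rcases lt_or_gt_of_ne hv with h' | h'
  · exact absurd (gammaPDF_of_neg h') h
  · exact h'

end Surveillance

/-! ### Averaging over a Gaussian vector by a gamma mixture. -/

namespace Surveillance

/-- The Laplace transform of a gamma variable, averaged over a Gaussian vector. -/
lemma integral_exp_neg_mul_inv_pow_gaussianVector {ι : Type*} [Fintype ι] (M : ℕ) {v d e K β : ℝ}
    (hv : 0 < v) (hd : 0 ≤ d) (he : 0 < e) (hK : K * (v * e) = 1) (hβ : β = K * (1 + v * d)) :
    ∫ x, Real.exp (-(‖x‖ ^ 2 * d)) * (1 + ‖x‖ ^ 2 * e)⁻¹ ^ (M + 1) ∂gaussianVector ι v =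
      K ^ Fintype.card ι * ∑ k ∈ Finset.range (M + 1),
        (-1 : ℝ) ^ k / (k.factorial * (M - k).factorial) * β ^ k *
        Real.exp β * upperGamma ((M : ℝ) + 1 - Fintype.card ι - k) β := by
  have hK0 : 0 < K := pos_of_mul_pos_left (hK ▸ one_pos) (by positivity)
  have hβ0 : 0 < β := by rw [hβ]; positivity
  have := isProbabilityMeasure_gammaMeasure (a := (M : ℝ) + 1) (by positivity) one_pos
  have h1 : ∀ x : EuclideanSpace ℂ ι,
      Real.exp (-(‖x‖ ^ 2 * d)) * (1 + ‖x‖ ^ 2 * e)⁻¹ ^ (M + 1) =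
      ∫ t, Real.exp (-((d + e * t) * ‖x‖ ^ 2)) ∂gammaMeasure (M + 1) 1 := by
    intro x
    rw [← integral_exp_neg_gammaMeasure_succ_one M (by positivity), ← integral_const_mul]
    simp_rw [← Real.exp_add]
    congr with t
    ring_nf
  have hint : Integrable (Function.uncurry fun (x : EuclideanSpace ℂ ι) (t : ℝ) =>
      Real.exp (-((d + e * t) * ‖x‖ ^ 2)))
      ((gaussianVector ι v).prod (gammaMeasure (M + 1) 1)) := by
    refine Integrable.of_bound (C := 1) (by fun_prop) ?_
    filter_upwards [Measure.quasiMeasurePreserving_snd.ae (gammaMeasure_ae_pos (M + 1) 1)]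
      with p hp
    simp only [Function.uncurry, Real.norm_eq_abs, Real.abs_exp, Real.exp_le_one_iff,
      Left.neg_nonpos_iff]
    positivity
  simp_rw [h1]
  rw [integral_integral_swap hint]
  have h2 : ∀ᵐ t ∂gammaMeasure (M + 1) 1,
      ∫ x, Real.exp (-((d + e * t) * ‖x‖ ^ 2)) ∂gaussianVector ι v =
        K ^ Fintype.card ι * ((t + β) ^ Fintype.card ι)⁻¹ := by
    filter_upwards [gammaMeasure_ae_pos (M + 1) 1] with t ht
    rw [integral_exp_neg_norm_sq_gaussianVector hv (by positivity), ← inv_pow, ← mul_pow]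
    congr 1
    -- `K` and `β` are chosen for this identity: `K` normalizes the slope in `t` to `1`, and `β` is
    -- the resulting shift.
    have : 1 + (d + e * t) * v = (t + β) / K := by
      rw [eq_div_iff hK0.ne', hβ]
      linear_combination t * hK
    rw [this, inv_div, div_eq_mul_inv]
  rw [integral_congr_ae h2, integral_const_mul, integral_gammaMeasure_succ_one,
    integral_pow_mul_exp_neg_mul_inv_add_pow M _ hβ0]

/-! ### Independence and Fubini. -/

section Independence

variable {Ω : Type*} [MeasurableSpace Ω] {P : Measure Ω}

lemma indepFun_comp_of_forall_ne {ι κ₁ κ₂ : Type*} [Fintype κ₁] [Fintype κ₂] {β : Type*}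
    [MeasurableSpace β] {Z : ι → Ω → β} (hZ : iIndepFun Z P) (hm : ∀ i, AEMeasurable (Z i) P)
    {g₁ : κ₁ → ι} {g₂ : κ₂ → ι} (hg : ∀ a b, g₁ a ≠ g₂ b) :
    IndepFun (fun ω a => Z (g₁ a) ω) (fun ω b => Z (g₂ b) ω) P := by
  classical
  have hdisj : Disjoint (Finset.univ.image g₁) (Finset.univ.image g₂) := by
    rw [Finset.disjoint_left]
    rintro _ ha hb
    obtain ⟨a, -, rfl⟩ := Finset.mem_image.1 ha
    obtain ⟨b, -, hb⟩ := Finset.mem_image.1 hb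
    exact hg a b hb.symm
  have h := hZ.indepFun_finset₀ _ _ hdisj hm
  exact h.comp
    (φ := fun x a => x ⟨g₁ a, Finset.mem_image_of_mem _ (Finset.mem_univ a)⟩)
    (ψ := fun x b => x ⟨g₂ b, Finset.mem_image_of_mem _ (Finset.mem_univ b)⟩)
    (measurable_pi_lambda _ fun _ => measurable_pi_apply _)
    (measurable_pi_lambda _ fun _ => measurable_pi_apply _)

variable {α β : Type*} [MeasurableSpace α] [MeasurableSpace β]
  {X : Ω → α} {Y : Ω → β} {μ : Measure α}

/-- By independence the joint law is a product, so `Y` may be frozen while the null set in `X` is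
checked. -/
lemma ae_of_indepFun_of_hasLaw [IsProbabilityMeasure P] [SFinite μ] (hXY : IndepFun Y X P) (hX : HasLaw X μ P)
    (hY : AEMeasurable Y P) {s : Set (β × α)} (hs : MeasurableSet s)
    (h : ∀ᵐ ω ∂P, ∀ᵐ x ∂μ, (Y ω, x) ∈ s) : ∀ᵐ ω ∂P, (Y ω, X ω) ∈ s := by
  have hlaw := (indepFun_iff_map_prod_eq_prod_map_map hY hX.aemeasurable).1 hXY
  rw [hX.map_eq] at hlaw
  refine ae_of_ae_map (hY.prodMk hX.aemeasurable) ?_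
  rw [hlaw, Measure.ae_prod_mem_iff_ae_ae_mem hs, ae_map_iff hY]
  · exact h
  · exact measurableSet_eq_fun (measurable_measure_prodMk_left hs.compl) measurable_const

lemma integral_of_indepFun_of_hasLaw [IsProbabilityMeasure P] [IsProbabilityMeasure μ] (hXY : IndepFun Y X P)
    (hX : HasLaw X μ P) (hY : AEMeasurable Y P) {f : β × α → ℝ} (hf : Measurable f)
    {C : ℝ} (hC : ∀ p, ‖f p‖ ≤ C) :
    ∫ ω, f (Y ω, X ω) ∂P = ∫ ω, ∫ x, f (Y ω, x) ∂μ ∂P := by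
  have := Measure.isProbabilityMeasure_map hY
  have hlaw := (indepFun_iff_map_prod_eq_prod_map_map hY hX.aemeasurable).1 hXY
  rw [hX.map_eq] at hlaw
  rw [← integral_map (hY.prodMk hX.aemeasurable) hf.aestronglyMeasurable, hlaw,
    integral_prod _ (Integrable.of_bound hf.aestronglyMeasurable C (ae_of_all _ hC)),
    integral_map hY hf.stronglyMeasurable.integral_prod_right'.aestronglyMeasurable]

lemma hasLaw_gaussianVector {ι : Type*} [Fintype ι] {Z : ι → Ω → ℂ} (hZ : iIndepFun Z P) {v : ℝ}
    (hlaw : ∀ i, HasLaw (Z i) (complexGaussian v) P) :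
    HasLaw (fun ω => WithLp.toLp 2 fun i => Z i ω) (gaussianVector ι v) P :=
  (measurePreserving_toLp_gaussianVector v).fun_comp_hasLaw (hZ.hasLaw_pi hlaw)

end Independence

end Surveillance

/-! ### Consequences of the fading model. -/

namespace Surveillance

lemma orthogonalNormSq_nonneg {ι : Type*} [Fintype ι] (b h : EuclideanSpace ℂ ι) :
    0 ≤ orthogonalNormSq b h := by
  rw [← norm_sq_orthogonalPart]
  positivity

@[fun_prop]
lemma measurable_orthogonalNormSq {ι α : Type*} [Fintype ι] [MeasurableSpace α]
    {f g : α → EuclideanSpace ℂ ι} (hf : Measurable f) (hg : Measurable g) :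
    Measurable fun a => orthogonalNormSq (f a) (g a) := by
  unfold orthogonalNormSq
  fun_prop

section Model

variable {Ω : Type*} [MeasurableSpace Ω] {P : Measure Ω} {Nr Nt : ℕ}
  {lam1 lam2 lam3 lam4 : ℝ} {hsd : Ω → ℂ} {hse : Ω → Fin Nr → ℂ} {hed : Ω → Fin Nt → ℂ}
  {Hee : Ω → Matrix (Fin Nr) (Fin Nt) ℂ}

namespace FadingModel

variable (hm : FadingModel P lam1 lam2 lam3 lam4 hsd hse hed Hee)
include hm

lemma aemeasurable_channelCoeff (i) : AEMeasurable (channelCoeff hsd hse hed Hee i) P := by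
  rcases i with _ | i | j | ⟨i, j⟩
  · exact hm.law_sd.aemeasurable
  · exact (hm.law_se i).aemeasurable
  · exact (hm.law_ed j).aemeasurable
  · exact (hm.law_ee i j).aemeasurable

lemma hasLaw_se : HasLaw (fun ω => WithLp.toLp 2 (hse ω)) (gaussianVector (Fin Nr) lam2) P :=
  hasLaw_gaussianVector (hm.indep.precomp (Sum.inr_injective.comp Sum.inl_injective)) hm.law_se

lemma hasLaw_ed : HasLaw (fun ω => WithLp.toLp 2 (hed ω)) (gaussianVector (Fin Nt) lam3) P :=
  hasLaw_gaussianVector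
    (hm.indep.precomp (Sum.inr_injective.comp (Sum.inr_injective.comp Sum.inl_injective))) hm.law_ed

lemma hasLaw_ee_col (j : Fin Nt) :
    HasLaw (fun ω => WithLp.toLp 2 fun i => Hee ω i j) (gaussianVector (Fin Nr) lam4) P :=
  hasLaw_gaussianVector
    (Z := fun i => channelCoeff hsd hse hed Hee (.inr (.inr (.inr (i, j)))))
    (hm.indep.precomp (g := fun i : Fin Nr => .inr (.inr (.inr (i, j))))
      fun a b hab => by simpa using hab) fun i => hm.law_ee i j

lemma indepFun_se_ee_col (j : Fin Nt) :
    IndepFun (fun ω => (WithLp.toLp 2 (hse ω) : EuclideanSpace ℂ (Fin Nr)))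
      (fun ω => (WithLp.toLp 2 fun i => Hee ω i j : EuclideanSpace ℂ (Fin Nr))) P :=
  (indepFun_comp_of_forall_ne hm.indep hm.aemeasurable_channelCoeff
    (g₁ := fun i : Fin Nr => .inr (.inl i)) (g₂ := fun i : Fin Nr => .inr (.inr (.inr (i, j))))
    (by simp)).comp (WithLp.measurable_toLp 2 _) (WithLp.measurable_toLp 2 _)

lemma indepFun_monitor_ed :
    IndepFun (fun ω => ((WithLp.toLp 2 (hse ω) : EuclideanSpace ℂ (Fin Nr)),
        loopChannel (hse ω) (Hee ω)))
      (fun ω => (WithLp.toLp 2 (hed ω) : EuclideanSpace ℂ (Fin Nt))) P := by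
  refine (indepFun_comp_of_forall_ne hm.indep hm.aemeasurable_channelCoeff
    (g₁ := fun i : Fin Nr ⊕ Fin Nr × Fin Nt => .inr (Sum.map id .inr i))
    (g₂ := fun i : Fin Nt => .inr (.inr (.inl i))) (by simp)).comp
    (φ := fun x => ((WithLp.toLp 2 fun i => x (.inl i) : EuclideanSpace ℂ (Fin Nr)),
      loopChannel (fun i => x (.inl i)) (fun i j => x (.inr (i, j)))))
    ?_ (WithLp.measurable_toLp 2 _)
  unfold loopChannel vecMul dotProduct
  simp only [Pi.star_apply]
  fun_prop

lemma indepFun_all_sd :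
    IndepFun (fun ω => (((WithLp.toLp 2 (hse ω) : EuclideanSpace ℂ (Fin Nr)),
        loopChannel (hse ω) (Hee ω)), (WithLp.toLp 2 (hed ω) : EuclideanSpace ℂ (Fin Nt))))
      hsd P := by
  refine (indepFun_comp_of_forall_ne hm.indep hm.aemeasurable_channelCoeff
    (g₁ := .inr) (g₂ := fun i : Unit => .inl i) (by simp)).comp
    (φ := fun x => (((WithLp.toLp 2 fun i => x (.inl i) : EuclideanSpace ℂ (Fin Nr)),
      loopChannel (fun i => x (.inl i)) (fun i j => x (.inr (.inr (i, j))))),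
      (WithLp.toLp 2 fun j => x (.inr (.inl j)) : EuclideanSpace ℂ (Fin Nt))))
    (ψ := fun x : Unit → ℂ => x ()) ?_ (measurable_pi_apply (X := fun _ => ℂ) ())
  unfold loopChannel vecMul dotProduct
  simp only [Pi.star_apply]
  fun_prop

lemma aemeasurable_monitor :
    AEMeasurable (fun ω => ((WithLp.toLp 2 (hse ω) : EuclideanSpace ℂ (Fin Nr)),
        loopChannel (hse ω) (Hee ω))) P := by
  have h1 : ∀ i, AEMeasurable (fun ω => hse ω i) P := fun i => (hm.law_se i).aemeasurable
  have h2 : ∀ i j, AEMeasurable (fun ω => Hee ω i j) P := fun i j =>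
    (hm.law_ee i j).aemeasurable
  refine hm.hasLaw_se.aemeasurable.prodMk
    ((WithLp.measurable_toLp 2 _).comp_aemeasurable (aemeasurable_pi_lambda _ fun j => ?_))
  simp only [vecMul, dotProduct, Pi.star_apply]
  fun_prop

lemma ae_hse_ne_zero (hlam2 : 0 < lam2) (hNr : 1 ≤ Nr) : ∀ᵐ ω ∂P, hse ω ≠ 0 := by
  have := hm.hasLaw_se.map_eq ▸ gaussianVector_ae_apply_ne_zero hlam2 (⟨0, hNr⟩ : Fin Nr)
  filter_upwards [ae_of_ae_map hm.hasLaw_se.aemeasurable this] with ω hω h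
  simp [h] at hω

variable [IsProbabilityMeasure P]

/-- One coordinate suffices: it is the inner product of `hse` with an independent Gaussian column of
`Hee`. -/
lemma ae_loopChannel_ne_zero (hlam2 : 0 < lam2) (hlam4 : 0 < lam4) (hNr : 1 ≤ Nr)
    (hNt : 1 < Nt) : ∀ᵐ ω ∂P, loopChannel (hse ω) (Hee ω) ≠ 0 := by
  let j : Fin Nt := ⟨0, by omega⟩
  have h := ae_of_indepFun_of_hasLaw (hm.indepFun_se_ee_col j) (hm.hasLaw_ee_col j)
    hm.hasLaw_se.aemeasurable (s := {p | inner ℂ p.1 p.2 ≠ 0})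
    (measurableSet_eq_fun (by fun_prop) measurable_const).compl (by
      filter_upwards [hm.ae_hse_ne_zero hlam2 hNr] with ω hω
      exact gaussianVector_ae_inner_ne_zero hlam4 (by simpa using hω))
  filter_upwards [h] with ω hω h0
  refine hω ?_
  have h1 : loopChannel (hse ω) (Hee ω) j = 0 := by rw [h0]; rfl
  rw [EuclideanSpace.inner_eq_star_dotProduct, dotProduct_comm]
  exact h1

lemma ae_orthogonalNormSq_pos (hlam2 : 0 < lam2) (hlam3 : 0 < lam3) (hlam4 : 0 < lam4)
    (hNr : 1 ≤ Nr) (hNt : 1 < Nt) :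
    ∀ᵐ ω ∂P, 0 < orthogonalNormSq (loopChannel (hse ω) (Hee ω)) (WithLp.toLp 2 (hed ω)) := by
  have : Nontrivial (Fin Nt) := Fin.nontrivial_iff_two_le.2 hNt
  refine ae_of_indepFun_of_hasLaw hm.indepFun_monitor_ed hm.hasLaw_ed hm.aemeasurable_monitor
    (s := {p | 0 < orthogonalNormSq p.1.2 p.2})
    (measurableSet_lt measurable_const (by fun_prop)) ?_
  filter_upwards [hm.ae_loopChannel_ne_zero hlam2 hlam4 hNr hNt] with ω hω
  exact gaussianVector_ae_orthogonalNormSq_pos hlam3 hω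

/-- The outage probability after averaging over `h_sd` and `h_ed`. -/
lemma integral_indicator_threshold {PJ ND NE : ℝ} (hlam1 : 0 < lam1) (hlam2 : 0 < lam2)
    (hlam3 : 0 < lam3) (hlam4 : 0 < lam4) (hPJ : 0 < PJ) (hND : 0 < ND) (hNE : 0 < NE)
    (hNr : 1 ≤ Nr) (hNt : 1 < Nt) :
    ∫ ω, (if l2norm (hse ω) ^ 2 * (PJ * orthogonalNormSq (loopChannel (hse ω) (Hee ω))
        (WithLp.toLp 2 (hed ω)) + ND) / NE < ‖hsd ω‖ ^ 2 then (1 : ℝ) else 0) ∂P =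
      ∫ x, Real.exp (-(‖x‖ ^ 2 * (ND / (lam1 * NE)))) *
        (1 + ‖x‖ ^ 2 * (lam3 * PJ / (lam1 * NE)))⁻¹ ^ (Nt - 1) ∂gaussianVector (Fin Nr) lam2 := by
  let T : (EuclideanSpace ℂ (Fin Nr) × EuclideanSpace ℂ (Fin Nt)) × EuclideanSpace ℂ (Fin Nt) → ℝ :=
    fun p => ‖p.1.1‖ ^ 2 * (PJ * orthogonalNormSq p.1.2 p.2 + ND) / NE
  have hT : Measurable T := by unfold T; fun_prop
  have hT0 : ∀ p, 0 ≤ T p := fun p => by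
    have := orthogonalNormSq_nonneg p.1.2 p.2
    unfold T
    positivity
  have step1 := integral_of_indepFun_of_hasLaw hm.indepFun_all_sd hm.law_sd
    (hm.aemeasurable_monitor.prodMk hm.hasLaw_ed.aemeasurable)
    (f := fun q => if T q.1 < ‖q.2‖ ^ 2 then (1 : ℝ) else 0)
    (Measurable.ite (measurableSet_lt (by fun_prop) (by fun_prop)) measurable_const
      measurable_const) (C := 1) (fun q => by split_ifs <;> simp)
  have step2 : ∀ p, ∫ z, (if T p < ‖z‖ ^ 2 then (1 : ℝ) else 0) ∂complexGaussian lam1 =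
      Real.exp (-(lam1⁻¹ * T p)) := fun p => by
    simpa using integral_exp_neg_sq_norm_of_lt_complexGaussian hlam1 le_rfl (hT0 p)
  have step3 := integral_of_indepFun_of_hasLaw hm.indepFun_monitor_ed hm.hasLaw_ed
    hm.aemeasurable_monitor (f := fun p => Real.exp (-(lam1⁻¹ * T p))) (by fun_prop)
    (C := 1) (fun p => by
      rw [Real.norm_eq_abs, Real.abs_exp, Real.exp_le_one_iff, Left.neg_nonpos_iff]
      exact mul_nonneg (by positivity) (hT0 p))
  refine step1.trans ?_
  simp_rw [step2]
  -- Both sides become integrals over `P`; where the loop channel is nonzero, the inner integral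
  -- over `hed` depends only on `‖hse‖`.
  rw [step3, ← hm.hasLaw_se.integral_comp (by fun_prop)]
  refine integral_congr_ae ?_
  filter_upwards [hm.ae_loopChannel_ne_zero hlam2 hlam4 hNr hNt] with ω hω
  have hsplit : ∀ y, Real.exp (-(lam1⁻¹ * T ((WithLp.toLp 2 (hse ω),
      loopChannel (hse ω) (Hee ω)), y))) =
      Real.exp (-(‖(WithLp.toLp 2 (hse ω) : EuclideanSpace ℂ (Fin Nr))‖ ^ 2 *
        (ND / (lam1 * NE)))) *
      Real.exp (-(‖(WithLp.toLp 2 (hse ω) : EuclideanSpace ℂ (Fin Nr))‖ ^ 2 * (PJ / (lam1 * NE)) *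
        orthogonalNormSq (loopChannel (hse ω) (Hee ω)) y)) := by
    intro y
    rw [← Real.exp_add]
    congr 1
    simp only [T]
    field_simp
    ring
  simp_rw [hsplit]
  rw [integral_const_mul, integral_exp_neg_orthogonalNormSq hlam3 (by positivity) hω,
    Fintype.card_fin, Function.comp_apply]
  ring_nf

end FadingModel

end Model

end Surveillance

/-! ### Assembly of the closed form. -/

theorem theorem6 {Ω : Type*} [MeasurableSpace Ω] (P : Measure Ω) [IsProbabilityMeasure P]
    (Nr Nt : ℕ) (hNr : 1 ≤ Nr) (hNt : 1 < Nt)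
    (lam1 lam2 lam3 lam4 PS PJ ND NE ρ : ℝ)
    (hlam1 : 0 < lam1) (hlam2 : 0 < lam2) (hlam3 : 0 < lam3) (hlam4 : 0 < lam4)
    (hPS : 0 < PS) (hPJ : 0 < PJ) (hND : 0 < ND) (hNE : 0 < NE) (hρ0 : 0 ≤ ρ) (hρ1 : ρ ≤ 1)
    (hsd : Ω → ℂ) (hse : Ω → Fin Nr → ℂ) (hed : Ω → Fin Nt → ℂ)
    (Hee : Ω → Matrix (Fin Nr) (Fin Nt) ℂ)
    (hmodel : Surveillance.FadingModel P lam1 lam2 lam3 lam4 hsd hse hed Hee) :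
    (∀ᵐ ω ∂P, Surveillance.IsTZFTransmit (hse ω) (hed ω) (Hee ω)
      (Surveillance.tzfTransmit (hse ω) (hed ω) (Hee ω))) ∧
    ∀ wt : Ω → Fin Nt → ℂ,
      (∀ᵐ ω ∂P, Surveillance.IsTZFTransmit (hse ω) (hed ω) (Hee ω) (wt ω)) →
      Integrable (fun ω => Surveillance.eavesdropSuccess PS PJ ρ ND NE (hsd ω) (hse ω) (hed ω)
        (Hee ω) (Surveillance.mrcReceive (hse ω)) (wt ω)) P ∧
      ∫ ω, Surveillance.eavesdropSuccess PS PJ ρ ND NE (hsd ω) (hse ω) (hed ω)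
        (Hee ω) (Surveillance.mrcReceive (hse ω)) (wt ω) ∂P =
      1 - ∑ k ∈ Finset.range (Nt - 1),
        (-1 : ℝ) ^ k / ((k.factorial : ℝ) * ((Nt - k - 2).factorial : ℝ)) *
          (lam1 * NE / (lam2 * lam3 * PJ)) ^ Nr *
          (ND / (lam3 * PJ) + lam1 * NE / (lam2 * lam3 * PJ)) ^ k *
          Real.exp (ND / (lam3 * PJ) + lam1 * NE / (lam2 * lam3 * PJ)) *
          Surveillance.upperGamma ((Nt : ℝ) - Nr - k - 1)
            (ND / (lam3 * PJ) + lam1 * NE / (lam2 * lam3 * PJ)) := by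

  have hpos := hmodel.ae_orthogonalNormSq_pos hlam2 hlam3 hlam4 hNr hNt
  refine ⟨by filter_upwards [hpos] with ω hω using Surveillance.isTZFTransmit_tzfTransmit hω,
    fun wt hwt => ?_⟩
  let f : Ω → ℝ := fun ω => if Surveillance.l2norm (hse ω) ^ 2 *
    (PJ * Surveillance.orthogonalNormSq (Surveillance.loopChannel (hse ω) (Hee ω))
      (WithLp.toLp 2 (hed ω)) + ND) / NE < ‖hsd ω‖ ^ 2 then 1 else 0
  have hX : (fun ω => Surveillance.eavesdropSuccess PS PJ ρ ND NE (hsd ω) (hse ω) (hed ω)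
      (Hee ω) (Surveillance.mrcReceive (hse ω)) (wt ω)) =ᵐ[P] fun ω => 1 - f ω := by
    filter_upwards [hpos, hwt, hmodel.ae_hse_ne_zero hlam2 hNr] with ω h1 h2 h3
    exact Surveillance.eavesdropSuccess_eq hPS hPJ hND hNE h2 h1 h3
  have hf : Integrable f P := by
    have hmeas : AEMeasurable (fun ω => (((WithLp.toLp 2 (hse ω) : EuclideanSpace ℂ (Fin Nr)),
        Surveillance.loopChannel (hse ω) (Hee ω)),
        (WithLp.toLp 2 (hed ω) : EuclideanSpace ℂ (Fin Nt)), hsd ω)) P :=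
      hmodel.aemeasurable_monitor.prodMk
        (hmodel.hasLaw_ed.aemeasurable.prodMk hmodel.law_sd.aemeasurable)
    have hg : Measurable fun p : (EuclideanSpace ℂ (Fin Nr) ×
        EuclideanSpace ℂ (Fin Nt)) × EuclideanSpace ℂ (Fin Nt) × ℂ =>
        if ‖p.1.1‖ ^ 2 * (PJ * Surveillance.orthogonalNormSq p.1.2 p.2.1 + ND) / NE < ‖p.2.2‖ ^ 2
          then (1 : ℝ) else 0 :=
      Measurable.ite (measurableSet_lt (by fun_prop) (by fun_prop)) measurable_const
        measurable_const
    have hfm : AEMeasurable f P := by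
      simpa only [f, Surveillance.l2norm] using! hg.comp_aemeasurable hmeas
    exact Integrable.of_bound (C := 1) hfm.aestronglyMeasurable
      (ae_of_all _ fun ω => by simp only [f]; split_ifs <;> simp)
  -- No measurability of `wt` is assumed; integrability transfers from `1 - f`, which does not
  -- involve `wt`.
  refine ⟨((integrable_const 1).sub hf).congr hX.symm, ?_⟩
  rw [integral_congr_ae hX, integral_sub (integrable_const 1) hf,
    hmodel.integral_indicator_threshold hlam1 hlam2 hlam3 hlam4 hPJ hND hNE hNr hNt]
  -- The gamma shape `Nt - 1` becomes `M + 1`, clearing the truncated subtractions.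
  obtain ⟨M, rfl⟩ : ∃ M, Nt = M + 2 := ⟨Nt - 2, by omega⟩
  have hK : lam1 * NE / (lam2 * lam3 * PJ) * (lam2 * (lam3 * PJ / (lam1 * NE))) = 1 := by
    field_simp
  have hβ : ND / (lam3 * PJ) + lam1 * NE / (lam2 * lam3 * PJ) =
      lam1 * NE / (lam2 * lam3 * PJ) * (1 + lam2 * (ND / (lam1 * NE))) := by
    field_simp
    ring
  rw [show M + 2 - 1 = M + 1 by omega,
    Surveillance.integral_exp_neg_mul_inv_pow_gaussianVector M hlam2 (by positivity)
      (by positivity) hK hβ, Finset.mul_sum]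
  simp only [integral_const, probReal_univ, smul_eq_mul, mul_one, Fintype.card_fin]
  congr 1
  refine Finset.sum_congr rfl fun k _ => ?_
  rw [show M + 2 - k - 2 = M - k by omega,
    show ((M + 2 : ℕ) : ℝ) - Nr - k - 1 = (M : ℝ) + 1 - Nr - k by push_cast; ring]
  ring
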